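/- Corollary 5.7. A double-Heyting algebra is an algebra $\langle A,\wedge,\vee,\to,-,0,1\rangle$ such that $\langle A,\wedge,\vee,0,1\rangle$ is a bounded lattice and, for all $a,b,c\in A$, $a\wedge b\le c\iff a\le b\to c$ and $a-b\le c\iff a\le b\vee c$. Let $\mathcal V$ be the variety of all double-Heyting algebras. For a set $\Sigma\cup\{\varepsilon\}$ of equations in this signature, write $\Sigma\models_{\mathcal V}\varepsilon$ if every assignment of the variables in a member of $\mathcal V$ that satisfies all equations of $\Sigma$ also satisfies $\varepsilon$. Then: 1. $\mathcal V$ is not coherent: it is not the case that every finitely generated subalgebra of a finitely presented member of $\mathcal V$ is finitely presented (in $\mathcal V$). 2. $\mathcal V$ does not admit right uniform deductive interpolation: it is not the case that for all finite disjoint sets of variables $\bar x,\bar y$ and every finite set of equations $\Sigma(\bar x,\bar y)$ there is a finite set of equations $\Pi(\bar y)$ such that, for every equation $\varepsilon(\bar y,\bar z)$ (with $\bar z$ disjoint from $\bar x,\bar y$), $\Sigma\models_{\mathcal V}\varepsilon\iff\Pi\models_{\mathcal V}\varepsilon$. 3. The first-order theory $T$ of $\mathcal V$ (the set of all first-order sentences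 true in all members of $\mathcal V$) has no model completion: there is no theory $T^*$ in the same language such that every model of $T^*$ is a model of $T$, every model of $T$ embeds into a model of $T^*$, and, for every model $M$ of $T$, the union of $T^*$ with the (quantifier-free) diagram of $M$ is a complete theory. -/

import Mathlib

open FirstOrder

universe u

namespace UniformInterpolation

/-! ### Equations and classes of algebras -/

/-- An `L`-equation `s ≈ t` in the variables `X`, as the pair `(s, t)`. -/
abbrev Eqn (L : FirstOrder.Language.{0, 0}) (X : Type) : Type := L.Term X × L.Term X

/-- The assignment `v : X → A` satisfies the equation `e`. -/
def Eqn.Holds {L : FirstOrder.Language.{0, 0}} {X : Type} (e : Eqn L X) {A : Type u} [L.Structure A]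
    (v : X → A) : Prop :=
  e.1.realize v = e.2.realize v

/-- Renaming of the variables of an equation. -/
def Eqn.rename {L : FirstOrder.Language.{0, 0}} {X Y : Type} (f : X → Y) (e : Eqn L X) : Eqn L Y :=
  (e.1.relabel f, e.2.relabel f)

/-- A class of `L`-structures. -/
abbrev AlgClass (L : FirstOrder.Language.{0, 0}) : Type (u + 1) := ∀ A : Type u, L.Structure A → Prop

/-- `Entails V S e` is equational consequence `S ⊨_V e`: every assignment (that is, every
homomorphism from the term algebra) into a member of `V` which satisfies `S` satisfies `e`. -/
def Entails {L : FirstOrder.Language.{0, 0}} (V : AlgClass.{u} L) {X : Type}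
    (S : Set (Eqn L X)) (e : Eqn L X) : Prop :=
  ∀ (A : Type u) [inst : L.Structure A], V A inst → ∀ v : X → A,
    (∀ s ∈ S, s.Holds v) → e.Holds v

/-! ### Uniform deductive interpolation -/

/-- Right uniform deductive interpolation: for all finite sets of variables `X`, `Y` and every
finite set `S` of equations in `X, Y` there is a finite set `P` of equations in `Y` such that, for
every equation `e` in `Y, Z`, with `Z` any set of variables disjoint from `X` and `Y`,
`S ⊨_V e` if and only if `P ⊨_V e`. -/
def RightUniformDeductiveInterpolation {L : FirstOrder.Language.{0, 0}} (V : AlgClass.{u} L) : Prop :=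
  ∀ (X Y : Type) [Finite X] [Finite Y] (S : Set (Eqn L (X ⊕ Y))), S.Finite →
    ∃ P : Set (Eqn L Y), P.Finite ∧
      ∀ (Z : Type) (e : Eqn L (Y ⊕ Z)),
        Entails V (Eqn.rename (Sum.map id Sum.inl : X ⊕ Y → X ⊕ (Y ⊕ Z)) '' S)
            (e.rename Sum.inr) ↔
          Entails V (Eqn.rename (Sum.inl : Y → Y ⊕ Z) '' P) e

/-! ### Coherence -/

/-- `A` is a finitely presented member of `V`: it belongs to `V`, and there are finitely many
generators `g` of `A` satisfying a finite set `R` of relations such that every assignment of the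
generators in a member of `V` which satisfies `R` extends to a homomorphism. -/
def FinitelyPresented {L : FirstOrder.Language.{0, 0}} (V : AlgClass.{u} L) (A : Type u)
    [inst : L.Structure A] : Prop :=
  V A inst ∧ ∃ (n : ℕ) (g : Fin n → A) (R : Set (Eqn L (Fin n))),
    R.Finite ∧
    FirstOrder.Language.Substructure.closure L (Set.range g) = ⊤ ∧
    (∀ r ∈ R, r.Holds g) ∧
    ∀ (B : Type u) [instB : L.Structure B], V B instB → ∀ h : Fin n → B,
      (∀ r ∈ R, r.Holds h) → ∃ f : A →[L] B, ∀ i, f (g i) = h i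

/-- Every finitely generated subalgebra of a finitely presented member of `V` is finitely
presented. -/
def Coherent {L : FirstOrder.Language.{0, 0}} (V : AlgClass.{u} L) : Prop :=
  ∀ (A : Type u) [L.Structure A], FinitelyPresented V A →
    ∀ S : L.Substructure A, S.FG → FinitelyPresented V S

/-! ### Model completions -/

/-- The first-order theory of a class: all sentences true in all its members. -/
def theoryOf {L : FirstOrder.Language.{0, 0}} (V : AlgClass.{u} L) : L.Theory :=
  {φ | ∀ (A : Type u) [inst : L.Structure A], V A inst → A ⊨ φ}

/-- `T'` is a model completion of `T`: every model of `T'` is a model of `T`, every model of `T`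
embeds into a model of `T'`, and, for every model `M` of `T`, the union of `T'` with the diagram
of `M` is complete. The last clause is phrased semantically: any two models of `T'` into which `M`
embeds satisfy the same formulas with parameters from `M`. -/
structure IsModelCompletion {L : FirstOrder.Language.{0, 0}} (T T' : L.Theory) : Prop where
  model_of_model : ∀ (M : Type u) [L.Structure M] [Nonempty M], M ⊨ T' → M ⊨ T
  exists_embedding : ∀ (M : Type u) [L.Structure M] [Nonempty M], M ⊨ T →
    ∃ (N : Type u) (_ : L.Structure N) (_ : Nonempty N), N ⊨ T' ∧ Nonempty (M ↪[L] N)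
  complete_over : ∀ (M : Type u) [L.Structure M] [Nonempty M], M ⊨ T →
    ∀ (N₁ N₂ : Type u) [L.Structure N₁] [L.Structure N₂] [Nonempty N₁] [Nonempty N₂],
      N₁ ⊨ T' → N₂ ⊨ T' → ∀ (f₁ : M ↪[L] N₁) (f₂ : M ↪[L] N₂) (n : ℕ)
        (φ : L.Formula (Fin n)) (a : Fin n → M),
        φ.Realize (fun i => f₁ (a i)) ↔ φ.Realize (fun i => f₂ (a i))

/-! ### Double-Heyting algebras -/

/-- The operation symbols `∧, ∨, →, -, 0, 1`. -/
inductive DHFunc : ℕ → Type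
  | inf : DHFunc 2
  | sup : DHFunc 2
  | imp : DHFunc 2
  | sub : DHFunc 2
  | zero : DHFunc 0
  | one : DHFunc 0

/-- The algebraic signature of double-Heyting algebras. -/
def dhLang : FirstOrder.Language.{0, 0} := ⟨DHFunc, fun _ => Empty⟩

instance : dhLang.IsAlgebraic := fun _ => (inferInstance : IsEmpty Empty)

/-- The symbols of `dhLang` are interpreted in `A` by the operations of the bi-Heyting algebra
`A`, where `a ⇨ ·` is right adjoint to `a ⊓ ·` and `· \ b` is left adjoint to `b ⊔ ·`. -/
structure InterpretsOps (A : Type u) [dhLang.Structure A] [BiheytingAlgebra A] : Prop where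
  inf_eq : ∀ x y : A,
    FirstOrder.Language.Structure.funMap (L := dhLang) (M := A) DHFunc.inf ![x, y] = x ⊓ y
  sup_eq : ∀ x y : A,
    FirstOrder.Language.Structure.funMap (L := dhLang) (M := A) DHFunc.sup ![x, y] = x ⊔ y
  imp_eq : ∀ x y : A,
    FirstOrder.Language.Structure.funMap (L := dhLang) (M := A) DHFunc.imp ![x, y] = x ⇨ y
  sub_eq : ∀ x y : A,
    FirstOrder.Language.Structure.funMap (L := dhLang) (M := A) DHFunc.sub ![x, y] = x \ y
  zero_eq : FirstOrder.Language.Structure.funMap (L := dhLang) (M := A) DHFunc.zero ![] = ⊥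
  one_eq : FirstOrder.Language.Structure.funMap (L := dhLang) (M := A) DHFunc.one ![] = ⊤

/-- The variety of double-Heyting algebras: the `dhLang`-structures whose operations are those of
a bi-Heyting algebra. -/
def doubleHeyting : AlgClass.{u} dhLang := fun A _ =>
  ∃ _ : BiheytingAlgebra A, InterpretsOps A

end UniformInterpolation

/-! All three failures come from one system of equations: `z ≤ x ≤ y` and `x ≤ ¬∼x`. Since `¬∼` is
monotone and deflationary, a solution `x` forces `z ≤ (¬∼)ⁿ y` for every `n`. Conversely, these
inequalities suffice for a solution in an extension (`exists_extension_le_box`): every algebra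
embeds in the lower sets of its prime ideals, a completely distributive lattice, where `¬∼` commutes
with meets and `⨅ n, (¬∼)ⁿ y` is a solution.

No finite part of this infinite list is enough. On a zigzag poset the iterates of `¬∼` decrease
strictly, so each pair `(y, (¬∼)ⁿ y)` violates the next inequality, while in an ultrapower the class
of the sequence `(¬∼)ⁿ y` lies below every standard iterate. By Łoś, finitely many consequences
valid for the ultrapower pair already hold for some `(y, (¬∼)ⁿ y)`; this is
`boxConsequences_not_finitely_based`.

A right uniform interpolant, or a finite presentation of the subalgebra generated by `y, z` in the
algebra presented by the system, would be a finite basis. A model completion would make solvability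
in an extension of a model of it equivalent to solvability in that model, against the same
ultrapower. -/

namespace UniformInterpolation

open FirstOrder.Language

/-! ### The operation `a ↦ ¬∼a` -/

section Box

variable {A : Type u}

/-- The operation `a ↦ ¬∼a` of a bi-Heyting algebra. -/
def box [BiheytingAlgebra A] (a : A) : A := (￢a)ᶜ

theorem box_le [BiheytingAlgebra A] (a : A) : box a ≤ a := by
  have h : (￢a)ᶜ ≤ a ⊔ ￢a := by rw [sup_hnot_self]; exact le_top
  calc (￢a)ᶜ = (￢a)ᶜ ⊓ (a ⊔ ￢a) := (inf_eq_left.2 h).symm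
    _ = (￢a)ᶜ ⊓ a := by rw [inf_sup_left, compl_inf_self, sup_bot_eq]
    _ ≤ a := inf_le_right

theorem box_mono [BiheytingAlgebra A] : Monotone (box : A → A) :=
  fun _ _ h => compl_le_compl (hnot_anti h)

theorem iterate_box_antitone [BiheytingAlgebra A] (a : A) : Antitone fun n => box^[n] a :=
  antitone_nat_of_succ_le fun n => by
    rw [Function.iterate_succ_apply']
    exact box_le _

theorem le_iterate_box [BiheytingAlgebra A] {x y : A} (hxy : x ≤ y) (hx : x ≤ box x) (n : ℕ) :
    x ≤ box^[n] y := by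
  induction n with
  | zero => exact hxy
  | succ n ih =>
    rw [Function.iterate_succ_apply']
    exact hx.trans (box_mono ih)

/-- Joins distribute over infinite meets, so `∼` turns a meet into at most a join; meets distribute
over infinite joins, so `¬` turns that join back into a meet. -/
theorem iInf_box_le [CompletelyDistribLattice A] {ι : Type*} (f : ι → A) :
    ⨅ i, box (f i) ≤ box (⨅ i, f i) := by
  have h : ￢(⨅ i, f i) ≤ ⨆ i, ￢(f i) := by
    rw [hnot_le_iff_codisjoint_left, codisjoint_iff, sup_iInf_eq, iInf_eq_top]
    exact fun i => top_le_iff.1 <| (hnot_sup_self (f i)).ge.trans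
      (sup_le_sup_right (le_iSup (fun i => ￢(f i)) i) _)
  refine le_trans ?_ (compl_le_compl h)
  rw [le_compl_iff_disjoint_left, disjoint_iff, iSup_inf_eq, iSup_eq_bot]
  exact fun i => le_bot_iff.1 <| (inf_le_inf_left _ (iInf_le _ i)).trans
    (inf_compl_self (￢(f i))).le

theorem exists_le_box [CompletelyDistribLattice A] {y z : A} (h : ∀ n, z ≤ box^[n] y) :
    ∃ x, z ≤ x ∧ x ≤ y ∧ x ≤ box x := by
  -- The limit of the iterates: applying `box` termwise only shifts the index by one.
  refine ⟨⨅ n, box^[n] y, le_iInf h, iInf_le (fun n => box^[n] y) 0, ?_⟩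
  refine le_trans (le_iInf fun n => ?_) (iInf_box_le _)
  rw [← Function.iterate_succ_apply' box]
  exact iInf_le _ (n + 1)

end Box

/-! ### A bi-Heyting algebra in which the powers of `¬∼` are distinct -/

/-- The natural numbers, ordered as the zigzag `0 > 1 < 2 > 3 < ⋯`. -/
structure Fence : Type u where
  toNat : ℕ

namespace Fence

instance : PartialOrder Fence where
  le a b := a = b ∨ (a.toNat % 2 = 1 ∧ (a.toNat = b.toNat + 1 ∨ b.toNat = a.toNat + 1))
  le_refl a := Or.inl rfl
  le_trans a b c := by
    rintro (rfl | h) (rfl | h')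
    · exact Or.inl rfl
    · exact Or.inr h'
    · exact Or.inr h
    -- Odd points are minimal and even points maximal, so two strict steps never compose.
    · omega
  le_antisymm a b := by
    rintro (rfl | h) (h' | h')
    · rfl
    · rfl
    · exact h'.symm
    · omega

/-- The elements of the fence of index above `2 * n`. -/
def tail (n : ℕ) : LowerSet Fence.{u} where
  carrier := {k | 2 * n < k.toNat}
  lower' := by
    rintro a b (rfl | h) ha
    · exact ha
    · simp only [Set.mem_ofPred_eq] at ha ⊢
      omega

/-- The elements of the fence of index at most `2 * n + 1`. -/
def head (n : ℕ) : LowerSet Fence.{u} where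
  carrier := {k | k.toNat ≤ 2 * n + 1}
  lower' := by
    rintro a b (rfl | h) ha
    · exact ha
    · simp only [Set.mem_ofPred_eq] at ha ⊢
      omega

theorem mem_tail {n : ℕ} {k : Fence.{u}} : k ∈ tail n ↔ 2 * n < k.toNat := Iff.rfl

theorem mem_head {n : ℕ} {k : Fence.{u}} : k ∈ head n ↔ k.toNat ≤ 2 * n + 1 := Iff.rfl

/-- `∼` gives the down-closure of the set complement `{k ≤ 2n}`, which adds only the point `2n + 1`
below `2n`. -/
theorem hnot_tail (n : ℕ) : ￢(tail.{u} n) = head n := by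
  apply le_antisymm
  · rw [hnot_le_iff_codisjoint_left, codisjoint_iff_le_sup]
    intro k _
    rw [SetLike.mem_coe, LowerSet.mem_sup_iff, mem_head, mem_tail]
    omega
  · have key : ∀ k : Fence.{u}, k.toNat ≤ 2 * n → k ∈ ￢(tail.{u} n) := fun k hk => by
      have h : k ∈ tail n ⊔ ￢(tail.{u} n) := by rw [sup_hnot_self]; trivial
      exact (LowerSet.mem_sup_iff.1 h).resolve_left fun h => by rw [mem_tail] at h; omega
    intro k hk
    rcases (show k.toNat ≤ 2 * n + 1 from hk).lt_or_eq with h | h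
    · exact key k (by omega)
    · exact (￢(tail n)).lower (show k ≤ ⟨2 * n⟩ from Or.inr (by simp only; omega)) (key ⟨2 * n⟩ le_rfl)

/-- `¬` gives the points whose down-set misses the head. The point `2n + 2` lies outside the head
but above `2n + 1`, so it is lost too. -/
theorem compl_head (n : ℕ) : (head.{u} n)ᶜ = tail (n + 1) := by
  apply le_antisymm
  · have key : ∀ k : Fence.{u}, k.toNat ≤ 2 * n + 1 → k ∉ (head.{u} n)ᶜ := fun k hk hk' => by
      have h : k ∈ head n ⊓ (head.{u} n)ᶜ := LowerSet.mem_inf_iff.2 ⟨hk, hk'⟩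
      rw [inf_compl_self] at h
      exact h
    intro k hk
    change 2 * (n + 1) < k.toNat
    by_contra h
    by_cases h' : k.toNat ≤ 2 * n + 1
    · exact key k h' hk
    · exact key ⟨2 * n + 1⟩ le_rfl (((head n)ᶜ).lower
        (show ⟨2 * n + 1⟩ ≤ k from Or.inr (by simp only; omega)) hk)
  · rw [le_compl_iff_disjoint_left, disjoint_iff_inf_le]
    intro k hk
    have h := LowerSet.mem_inf_iff.1 (show k ∈ head n ⊓ tail (n + 1) from hk)
    rw [mem_head, mem_tail] at h
    omega

theorem iterate_box_tail (n : ℕ) : box^[n] (tail.{u} 0) = tail n := by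
  induction n with
  | zero => rfl
  | succ n ih => rw [Function.iterate_succ_apply', ih, box, hnot_tail, compl_head]

theorem not_iterate_box_tail_le (n : ℕ) :
    ¬ box^[n] (tail.{u} 0) ≤ box^[n + 1] (tail.{u} 0) := by
  rw [iterate_box_tail, iterate_box_tail]
  intro h
  have h' : (⟨2 * n + 1⟩ : Fence.{u}) ∈ tail (n + 1) :=
    h (show (⟨2 * n + 1⟩ : Fence.{u}) ∈ tail n by rw [mem_tail]; simp only; omega)
  rw [mem_tail] at h'
  simp only at h'
  omega

end Fence

/-! ### The embedding into the lower sets of prime ideals -/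

section PrimeIdeals

open Order

variable {A : Type u}

/-- The lower set of the prime ideals that do not contain `a`. -/
def primeSpec [Lattice A] (a : A) : LowerSet {J : Ideal A // J.IsPrime} where
  carrier := {J | a ∉ J.1}
  lower' := fun _ _ h ha h' => ha (h h')

theorem mem_primeSpec [Lattice A] {a : A} {J : {J : Ideal A // J.IsPrime}} :
    J ∈ primeSpec a ↔ a ∉ J.1 := Iff.rfl

/-- The prime ideal theorem for sets closed only under `⊓`, respectively `⊔`; their upward and
downward closures are the filter and the ideal to be separated. -/
theorem exists_prime_ideal [DistribLattice A] (F I : Set A)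
    (hF : F.Nonempty) (hFinf : ∀ a ∈ F, ∀ b ∈ F, a ⊓ b ∈ F)
    (hI : I.Nonempty) (hIsup : ∀ a ∈ I, ∀ b ∈ I, a ⊔ b ∈ I)
    (hFI : ∀ a ∈ F, ∀ b ∈ I, ¬ a ≤ b) :
    ∃ J : Ideal A, J.IsPrime ∧ I ⊆ J ∧ ∀ a ∈ F, a ∉ J := by
  let F' : PFilter A := IsPFilter.toPFilter (F := {x | ∃ a ∈ F, a ≤ x}) <| .of_def
    (hF.imp fun a ha => ⟨a, ha, le_rfl⟩)
    (by
      rintro x ⟨a, ha, hax⟩ y ⟨b, hb, hby⟩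
      exact ⟨a ⊓ b, ⟨_, hFinf a ha b hb, le_rfl⟩, inf_le_left.trans hax, inf_le_right.trans hby⟩)
    (fun h => by
      rintro ⟨a, ha, hax⟩
      exact ⟨a, ha, hax.trans h⟩)
  let I' : Ideal A :=
    { carrier := {x | ∃ a ∈ I, x ≤ a}
      lower' := fun x y h ⟨a, ha, hxa⟩ => ⟨a, ha, h.trans hxa⟩
      nonempty' := hI.imp fun a ha => ⟨a, ha, le_rfl⟩
      directed' := by
        rintro x ⟨a, ha, hxa⟩ y ⟨b, hb, hyb⟩
        exact ⟨a ⊔ b, ⟨_, hIsup a ha b hb, le_rfl⟩, hxa.trans le_sup_left,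
          hyb.trans le_sup_right⟩ }
  have hdisj : Disjoint (F' : Set A) (I' : Set A) := by
    rw [Set.disjoint_left]
    rintro x ⟨a, ha, hax⟩ ⟨b, hb, hxb⟩
    exact hFI a ha b hb (hax.trans hxb)
  obtain ⟨J, hJ, hIJ, hJF⟩ := DistribLattice.prime_ideal_of_disjoint_filter_ideal hdisj
  refine ⟨J, hJ, fun a ha => hIJ (show a ∈ I' from ⟨a, ha, le_rfl⟩), fun a ha haJ => ?_⟩
  exact Set.disjoint_left.1 hJF (show a ∈ (F' : Set A) from ⟨a, ha, le_rfl⟩) haJ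

theorem primeSpec_inf [DistribLattice A] (a b : A) :
    primeSpec (a ⊓ b) = primeSpec a ⊓ primeSpec b := by
  ext J
  simp only [SetLike.mem_coe, LowerSet.mem_inf_iff, mem_primeSpec]
  rw [← not_or, not_iff_not]
  exact ⟨J.2.mem_or_mem, fun h => h.elim (J.1.lower inf_le_left) (J.1.lower inf_le_right)⟩

theorem primeSpec_sup [DistribLattice A] (a b : A) :
    primeSpec (a ⊔ b) = primeSpec a ⊔ primeSpec b := by
  ext J
  simp only [SetLike.mem_coe, LowerSet.mem_sup_iff, mem_primeSpec]
  rw [← not_and_or, not_iff_not]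
  exact Ideal.sup_mem_iff

theorem primeSpec_bot [DistribLattice A] [OrderBot A] : primeSpec (⊥ : A) = ⊥ := by
  ext J
  simp [mem_primeSpec]

theorem primeSpec_top [DistribLattice A] [BoundedOrder A] : primeSpec (⊤ : A) = ⊤ := by
  ext J
  have := J.2.toIsProper
  simpa [mem_primeSpec] using Ideal.IsProper.top_notMem this

theorem primeSpec_le_iff [DistribLattice A] {a b : A} : primeSpec a ≤ primeSpec b ↔ a ≤ b := by
  refine ⟨fun h => ?_, fun h J hJ hb => hJ (J.1.lower h hb)⟩
  by_contra hab
  obtain ⟨J, hJ, hbJ, haJ⟩ := exists_prime_ideal {a} {b} ⟨a, rfl⟩ (by simp) ⟨b, rfl⟩ (by simp)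
    (by simpa using hab)
  exact h (show (⟨J, hJ⟩ : {J : Ideal A // J.IsPrime}) ∈ primeSpec a from haJ a rfl) (hbJ rfl)

theorem primeSpec_himp [HeytingAlgebra A] (a b : A) :
    primeSpec (a ⇨ b) = primeSpec a ⇨ primeSpec b := by
  apply le_antisymm
  · rw [le_himp_iff, ← primeSpec_inf, primeSpec_le_iff]
    exact himp_inf_le
  · intro J hJ hab
    -- If `a ⇨ b ∈ J`, the filter generated by `a` and the complement of `J` avoids `b`: from `a ⊓ c
    -- ≤ b` follows `c ≤ a ⇨ b`, hence `c ∈ J`. The resulting `K ⊆ J` contains `b` but not `a`.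
    obtain ⟨K, hK, hbK, hKF⟩ := exists_prime_ideal {x | ∃ c ∉ J.1, x = a ⊓ c} {b}
      (by
        obtain ⟨c, hc⟩ := Set.nonempty_compl.2 J.2.toIsProper.ne_univ
        exact ⟨_, c, hc, rfl⟩)
      (by
        rintro _ ⟨c, hc, rfl⟩ _ ⟨d, hd, rfl⟩
        refine ⟨c ⊓ d, fun h => (J.2.mem_or_mem h).elim hc hd, ?_⟩
        rw [← inf_inf_distrib_left])
      ⟨b, rfl⟩ (by simp)
      (by
        rintro _ ⟨c, hc, rfl⟩ _ rfl h
        exact hc (J.1.lower (le_himp_iff'.2 h) hab))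
    obtain ⟨d, hd⟩ := Set.nonempty_compl.2 J.2.toIsProper.ne_univ
    have hKJ : K ≤ J.1 := fun c hc => by
      by_contra hcJ
      exact hKF _ ⟨c, hcJ, rfl⟩ (K.lower inf_le_right hc)
    have haK : a ∉ K := fun h => hKF _ ⟨d, hd, rfl⟩ (K.lower inf_le_left h)
    let K' : {J : Ideal A // J.IsPrime} := ⟨K, hK⟩
    have hK' : K' ∈ (primeSpec a ⇨ primeSpec b) ⊓ primeSpec a :=
      LowerSet.mem_inf_iff.2 ⟨(primeSpec a ⇨ primeSpec b).lower (show K' ≤ J from hKJ) hJ, haK⟩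
    exact (himp_inf_le : (primeSpec a ⇨ primeSpec b) ⊓ primeSpec a ≤ primeSpec b) hK' (hbK rfl)

theorem primeSpec_sdiff [BiheytingAlgebra A] (a b : A) :
    primeSpec (a \ b) = primeSpec a \ primeSpec b := by
  apply le_antisymm
  · intro J hJ
    -- Dually, the ideal generated by `J` and `b` omits `a`: from `a ≤ b ⊔ c` with `c ∈ J` follows
    -- `a \ b ∈ J`. The resulting `K ⊇ J` contains `b` but not `a`.
    obtain ⟨K, hK, hKI, haK⟩ := exists_prime_ideal {a} {x | ∃ c ∈ J.1, x = b ⊔ c} ⟨a, rfl⟩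
      (by simp) (J.1.nonempty.imp' (fun c => b ⊔ c) fun c hc => ⟨c, hc, rfl⟩)
      (by
        rintro _ ⟨c, hc, rfl⟩ _ ⟨d, hd, rfl⟩
        exact ⟨c ⊔ d, Ideal.sup_mem hc hd, sup_sup_distrib_left b c d ▸ rfl⟩)
      (by
        rintro _ rfl _ ⟨c, hc, rfl⟩ h
        exact hJ (J.1.lower (sdiff_le_iff.2 h) hc))
    let K' : {J : Ideal A // J.IsPrime} := ⟨K, hK⟩
    have hJK : J ≤ K' := fun c hc => K.lower le_sup_right (hKI ⟨c, hc, rfl⟩)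
    obtain ⟨d, hd⟩ := J.1.nonempty
    have hbK : b ∈ K := K.lower le_sup_left (hKI ⟨d, hd, rfl⟩)
    have hK' : K' ∈ primeSpec b ⊔ primeSpec a \ primeSpec b :=
      (le_sup_sdiff : primeSpec a ≤ primeSpec b ⊔ primeSpec a \ primeSpec b) (show K' ∈ primeSpec a from haK a rfl)
    exact (primeSpec a \ primeSpec b).lower hJK
      ((LowerSet.mem_sup_iff.1 hK').resolve_left fun h => h hbK)
  · rw [sdiff_le_iff, ← primeSpec_sup, primeSpec_le_iff]
    exact le_sup_sdiff

end PrimeIdeals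

/-! ### Terms and equations in the signature of double-Heyting algebras -/

section Terms

variable {X : Type}

/-- The term `s ∧ t`. -/
def infT (s t : dhLang.Term X) : dhLang.Term X := Functions.apply₂ (L := dhLang) DHFunc.inf s t

/-- The term `s ∨ t`. -/
def supT (s t : dhLang.Term X) : dhLang.Term X := Functions.apply₂ (L := dhLang) DHFunc.sup s t

/-- The term `s → t`. -/
def impT (s t : dhLang.Term X) : dhLang.Term X := Functions.apply₂ (L := dhLang) DHFunc.imp s t

/-- The term `s - t`. -/
def subT (s t : dhLang.Term X) : dhLang.Term X := Functions.apply₂ (L := dhLang) DHFunc.sub s t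

/-- The term `0`. -/
def zeroT : dhLang.Term X := Constants.term (L := dhLang) DHFunc.zero

/-- The term `1`. -/
def oneT : dhLang.Term X := Constants.term (L := dhLang) DHFunc.one

/-- The term `¬∼t`. -/
def boxT (t : dhLang.Term X) : dhLang.Term X := impT (subT oneT t) zeroT

/-- The equation `s ∧ t ≈ s`, which expresses `s ≤ t`. -/
def leEqn (s t : dhLang.Term X) : Eqn dhLang X := (infT s t, s)

section Realize

variable {A : Type u} [dhLang.Structure A] (s t : dhLang.Term X) (v : X → A)

theorem realize_infT : (infT s t).realize v =
    Structure.funMap (L := dhLang) DHFunc.inf ![s.realize v, t.realize v] :=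
  Term.realize_functions_apply₂

theorem realize_supT : (supT s t).realize v =
    Structure.funMap (L := dhLang) DHFunc.sup ![s.realize v, t.realize v] :=
  Term.realize_functions_apply₂

theorem realize_impT : (impT s t).realize v =
    Structure.funMap (L := dhLang) DHFunc.imp ![s.realize v, t.realize v] :=
  Term.realize_functions_apply₂

theorem realize_subT : (subT s t).realize v =
    Structure.funMap (L := dhLang) DHFunc.sub ![s.realize v, t.realize v] :=
  Term.realize_functions_apply₂

theorem realize_zeroT : (zeroT : dhLang.Term X).realize v =
    Structure.funMap (L := dhLang) DHFunc.zero ![] := by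
  change Structure.funMap (L := dhLang) DHFunc.zero _ = _
  exact congrArg _ (Subsingleton.elim _ _)

theorem realize_oneT : (oneT : dhLang.Term X).realize v =
    Structure.funMap (L := dhLang) DHFunc.one ![] := by
  change Structure.funMap (L := dhLang) DHFunc.one _ = _
  exact congrArg _ (Subsingleton.elim _ _)

end Realize

namespace InterpretsOps

variable {A : Type u} [dhLang.Structure A] [BiheytingAlgebra A]
  (s t : dhLang.Term X) (v : X → A)

theorem realize_inf (h : InterpretsOps A) : (infT s t).realize v = s.realize v ⊓ t.realize v := by
  rw [realize_infT, h.inf_eq]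

theorem realize_sup (h : InterpretsOps A) : (supT s t).realize v = s.realize v ⊔ t.realize v := by
  rw [realize_supT, h.sup_eq]

theorem realize_imp (h : InterpretsOps A) : (impT s t).realize v = s.realize v ⇨ t.realize v := by
  rw [realize_impT, h.imp_eq]

theorem realize_sub (h : InterpretsOps A) : (subT s t).realize v = s.realize v \ t.realize v := by
  rw [realize_subT, h.sub_eq]

theorem realize_zero (h : InterpretsOps A) : (zeroT : dhLang.Term X).realize v = ⊥ := by
  rw [realize_zeroT, h.zero_eq]

theorem realize_one (h : InterpretsOps A) : (oneT : dhLang.Term X).realize v = ⊤ := by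
  rw [realize_oneT, h.one_eq]

theorem realize_box (h : InterpretsOps A) : (boxT t).realize v = box (t.realize v) := by
  rw [boxT, h.realize_imp, h.realize_sub, h.realize_one, h.realize_zero, himp_bot, top_sdiff', box]

theorem realize_iterate_box (h : InterpretsOps A) (n : ℕ) : (boxT^[n] t).realize v = box^[n] (t.realize v) := by
  induction n with
  | zero => rfl
  | succ n ih => rw [Function.iterate_succ_apply', Function.iterate_succ_apply', h.realize_box, ih]

theorem leEqn_holds (h : InterpretsOps A) : (leEqn s t).Holds v ↔ s.realize v ≤ t.realize v := by
  rw [Eqn.Holds, leEqn, h.realize_inf, inf_eq_left]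

end InterpretsOps

end Terms

/-! ### Structures from bi-Heyting algebras -/

/-- The interpretation of the operation symbols in a bi-Heyting algebra. -/
def interp {A : Type u} [BiheytingAlgebra A] : ∀ {n : ℕ}, DHFunc n → (Fin n → A) → A
  | _, .inf, x => x 0 ⊓ x 1
  | _, .sup, x => x 0 ⊔ x 1
  | _, .imp, x => x 0 ⇨ x 1
  | _, .sub, x => x 0 \ x 1
  | _, .zero, _ => ⊥
  | _, .one, _ => ⊤

/-- A bi-Heyting algebra as a `dhLang`-structure. -/
abbrev dhStructure (A : Type u) [BiheytingAlgebra A] : dhLang.Structure A where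
  funMap := interp
  RelMap := fun r => (r : Empty).elim

theorem interpretsOps_dhStructure (A : Type u) [BiheytingAlgebra A] :
    letI := dhStructure A
    InterpretsOps A := by
  let := dhStructure A
  exact ⟨fun _ _ => rfl, fun _ _ => rfl, fun _ _ => rfl, fun _ _ => rfl, rfl, rfl⟩

/-- An injective map that preserves the bi-Heyting operations is an embedding of structures. -/
def embeddingOfPreserves {A B : Type u} [dhLang.Structure A] [BiheytingAlgebra A]
    [dhLang.Structure B] [BiheytingAlgebra B] (hA : InterpretsOps A) (hB : InterpretsOps B)
    (f : A → B) (hf : Function.Injective f) (hinf : ∀ a b, f (a ⊓ b) = f a ⊓ f b)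
    (hsup : ∀ a b, f (a ⊔ b) = f a ⊔ f b) (himp : ∀ a b, f (a ⇨ b) = f a ⇨ f b)
    (hsub : ∀ a b, f (a \ b) = f a \ f b) (hbot : f ⊥ = ⊥) (htop : f ⊤ = ⊤) :
    A ↪[dhLang] B where
  toFun := f
  inj' := hf
  map_fun' := by
    intro n F x
    have h2 : ∀ x : Fin 2 → A, x = ![x 0, x 1] ∧ f ∘ x = ![f (x 0), f (x 1)] := fun x =>
      ⟨by funext i; fin_cases i <;> rfl, by funext i; fin_cases i <;> rfl⟩
    have h0 : ∀ x : Fin 0 → A, x = ![] ∧ f ∘ x = ![] := fun x =>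
      ⟨Subsingleton.elim _ _, Subsingleton.elim _ _⟩
    cases F
    · rw [(h2 x).2, (h2 x).1, hA.inf_eq, hB.inf_eq]
      exact hinf _ _
    · rw [(h2 x).2, (h2 x).1, hA.sup_eq, hB.sup_eq]
      exact hsup _ _
    · rw [(h2 x).2, (h2 x).1, hA.imp_eq, hB.imp_eq]
      exact himp _ _
    · rw [(h2 x).2, (h2 x).1, hA.sub_eq, hB.sub_eq]
      exact hsub _ _
    · rw [(h0 x).2, (h0 x).1, hA.zero_eq, hB.zero_eq]
      exact hbot
    · rw [(h0 x).2, (h0 x).1, hA.one_eq, hB.one_eq]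
      exact htop
  map_rel' := fun r => (r : Empty).elim

/-- If `z` is below all `box^[n] y`, then an extension contains `x` with `z ≤ x ≤ y` and
`x ≤ box x`. -/
theorem exists_extension_le_box {A : Type u} [dhLang.Structure A] [BiheytingAlgebra A]
    (hA : InterpretsOps A) {y z : A} (h : ∀ n, z ≤ box^[n] y) :
    ∃ (B : Type u) (_ : dhLang.Structure B) (_ : BiheytingAlgebra B) (_ : InterpretsOps B)
      (f : A ↪[dhLang] B) (x : B), f z ≤ x ∧ x ≤ f y ∧ x ≤ box x := by
  let B := LowerSet {J : Order.Ideal A // J.IsPrime}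
  let := dhStructure B
  have hB := interpretsOps_dhStructure B
  let f : A ↪[dhLang] B := embeddingOfPreserves hA hB primeSpec
    (fun a b hab => le_antisymm (primeSpec_le_iff.1 hab.le) (primeSpec_le_iff.1 hab.ge))
    primeSpec_inf primeSpec_sup primeSpec_himp primeSpec_sdiff primeSpec_bot primeSpec_top
  have hbox : Function.Semiconj (primeSpec : A → B) box box := fun a => by
    rw [box, box, ← himp_bot, ← top_sdiff', primeSpec_himp, primeSpec_sdiff, primeSpec_bot,
      primeSpec_top, himp_bot, top_sdiff']
  obtain ⟨x, hzx, hxy, hx⟩ := exists_le_box (y := (primeSpec y : B)) (z := primeSpec z) fun n => by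
    rw [← hbox.iterate_right n, primeSpec_le_iff]
    exact h n
  exact ⟨B, _, inferInstance, hB, f, x, hzx, hxy, hx⟩

/-! ### Closure of the variety -/

theorem entails_empty_iff {X : Type} {s t : dhLang.Term X}
    (h : ∀ (B : Type u) [dhLang.Structure B] [BiheytingAlgebra B], InterpretsOps B →
      ∀ v : X → B, s.realize v = t.realize v) : Entails doubleHeyting.{u} ∅ (s, t) :=
  fun B _ ⟨_, hB⟩ v _ => h B hB v

/-- A structure that satisfies all valid equations is a double-Heyting algebra. -/
theorem doubleHeyting_of_forall_valid {A : Type u} [inst : dhLang.Structure A]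
    (h : ∀ e : Eqn dhLang (Fin 3), Entails doubleHeyting.{u} ∅ e → ∀ v : Fin 3 → A, e.Holds v) :
    doubleHeyting A inst := by
  let x : dhLang.Term (Fin 3) := .var 0
  let y : dhLang.Term (Fin 3) := .var 1
  let z : dhLang.Term (Fin 3) := .var 2
  have key : ∀ s t : dhLang.Term (Fin 3),
      (∀ (B : Type u) [dhLang.Structure B] [BiheytingAlgebra B], InterpretsOps B →
        ∀ v : Fin 3 → B, s.realize v = t.realize v) →
      ∀ a b c : A, s.realize ![a, b, c] = t.realize ![a, b, c] := fun s t hst a b c =>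
    h (s, t) (entails_empty_iff hst) _
  let inf (a b : A) : A := Structure.funMap (L := dhLang) DHFunc.inf ![a, b]
  let sup (a b : A) : A := Structure.funMap (L := dhLang) DHFunc.sup ![a, b]
  let imp (a b : A) : A := Structure.funMap (L := dhLang) DHFunc.imp ![a, b]
  let sub (a b : A) : A := Structure.funMap (L := dhLang) DHFunc.sub ![a, b]
  let zero : A := Structure.funMap (L := dhLang) DHFunc.zero ![]
  let one : A := Structure.funMap (L := dhLang) DHFunc.one ![]
  have inf_comm' : ∀ a b, inf a b = inf b a := fun a b => by
    have := key (infT x y) (infT y x)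
      (fun B _ _ hB v => by rw [hB.realize_inf, hB.realize_inf, inf_comm]) a b a
    rwa [realize_infT, realize_infT] at this
  have sup_comm' : ∀ a b, sup a b = sup b a := fun a b => by
    have := key (supT x y) (supT y x)
      (fun B _ _ hB v => by rw [hB.realize_sup, hB.realize_sup, sup_comm]) a b a
    rwa [realize_supT, realize_supT] at this
  have inf_assoc' : ∀ a b c, inf (inf a b) c = inf a (inf b c) := fun a b c => by
    have := key (infT (infT x y) z) (infT x (infT y z))
      (fun B _ _ hB v => by simp only [hB.realize_inf, inf_assoc]) a b c
    simp only [realize_infT] at this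
    exact this
  have sup_assoc' : ∀ a b c, sup (sup a b) c = sup a (sup b c) := fun a b c => by
    have := key (supT (supT x y) z) (supT x (supT y z))
      (fun B _ _ hB v => by simp only [hB.realize_sup, sup_assoc]) a b c
    simp only [realize_supT] at this
    exact this
  have sup_inf' : ∀ a b, sup a (inf a b) = a := fun a b => by
    have := key (supT x (infT x y)) x
      (fun B _ _ hB v => by rw [hB.realize_sup, hB.realize_inf, sup_inf_self]) a b a
    simp only [realize_supT, realize_infT] at this
    exact this
  have inf_sup' : ∀ a b, inf a (sup a b) = a := fun a b => by
    have := key (infT x (supT x y)) x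
      (fun B _ _ hB v => by rw [hB.realize_inf, hB.realize_sup, inf_sup_self]) a b a
    simp only [realize_supT, realize_infT] at this
    exact this
  let _ : Max A := ⟨sup⟩
  let _ : Min A := ⟨inf⟩
  let lat : Lattice A := Lattice.mk' sup_comm' sup_assoc' inf_comm' inf_assoc' sup_inf' inf_sup'
  have le_iff : ∀ a b : A, a ≤ b ↔ sup a b = b := fun a b => Iff.rfl
  have sup_zero : ∀ a, sup zero a = a := fun a => by
    have := key (supT zeroT x) x
      (fun B _ _ hB v => by rw [hB.realize_sup, hB.realize_zero, bot_sup_eq]) a a a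
    rwa [realize_supT, realize_zeroT] at this
  have sup_one : ∀ a, sup a one = one := fun a => by
    have := key (supT x oneT) oneT
      (fun B _ _ hB v => by rw [hB.realize_sup, hB.realize_one, sup_top_eq]) a a a
    rwa [realize_supT, realize_oneT] at this
  -- The adjunctions are conditional, hence not identities. Each is recovered from its unit, its
  -- counit and monotonicity, all written as identities `s ∨ t ≈ t`.
  have le_imp_inf : ∀ a b, a ≤ imp b (inf a b) := fun a b => by
    have := key (supT x (impT y (infT x y))) (impT y (infT x y))
      (fun B _ _ hB v => by
        simp only [hB.realize_sup, hB.realize_imp, hB.realize_inf, sup_eq_right, le_himp_iff]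
        exact le_rfl) a b a
    rw [le_iff]
    simp only [realize_supT, realize_infT, realize_impT] at this
    exact this
  have imp_mono : ∀ a b c, imp b (inf a c) ≤ imp b c := fun a b c => by
    have := key (supT (impT y (infT x z)) (impT y z)) (impT y z)
      (fun B _ _ hB v => by
        simp only [hB.realize_sup, hB.realize_imp, hB.realize_inf, sup_eq_right]
        exact himp_le_himp_left inf_le_right) a b c
    rw [le_iff]
    simp only [realize_supT, realize_infT, realize_impT] at this
    exact this
  have imp_inf_le : ∀ a b, inf (imp a b) a ≤ b := fun a b => by
    have := key (supT (infT (impT x y) x) y) y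
      (fun B _ _ hB v => by
        simp only [hB.realize_sup, hB.realize_imp, hB.realize_inf, sup_eq_right]
        exact himp_inf_le) a b a
    rw [le_iff]
    simp only [realize_supT, realize_infT, realize_impT] at this
    exact this
  have sub_sup_le : ∀ a b, sub (sup b a) b ≤ a := fun a b => by
    have := key (supT (subT (supT y x) y) x) x
      (fun B _ _ hB v => by
        simp only [hB.realize_sup, hB.realize_sub, sup_eq_right, sdiff_le_iff]
        exact le_rfl) a b a
    rw [le_iff]
    simp only [realize_supT, realize_subT] at this
    exact this
  have sub_mono : ∀ a b c, sub a b ≤ sub (sup a c) b := fun a b c => by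
    have := key (supT (subT x y) (subT (supT x z) y)) (subT (supT x z) y)
      (fun B _ _ hB v => by
        simp only [hB.realize_sup, hB.realize_sub, sup_eq_right]
        exact sdiff_le_sdiff_right le_sup_left) a b c
    rw [le_iff]
    simp only [realize_supT, realize_subT] at this
    exact this
  have le_sup_sub : ∀ a b, a ≤ sup b (sub a b) := fun a b => by
    have := key (supT x (supT y (subT x y))) (supT y (subT x y))
      (fun B _ _ hB v => by
        simp only [hB.realize_sup, hB.realize_sub]
        exact sup_eq_right.2 le_sup_sdiff) a b a
    rw [le_iff]
    simp only [realize_supT, realize_subT] at this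
    exact this
  let bi : BiheytingAlgebra A :=
    { lat with
      top := one
      bot := zero
      le_top := sup_one
      bot_le := sup_zero
      himp := imp
      sdiff := sub
      compl := fun a => imp a zero
      hnot := fun a => sub one a
      le_himp_iff := fun a b c => by
        constructor
        · intro h
          exact (inf_le_inf_right b h).trans (imp_inf_le b c)
        · intro h
          refine (le_imp_inf a b).trans ?_
          have h' : inf (inf a b) c = inf a b := inf_eq_left.2 h
          rw [← h']
          exact imp_mono _ b c
      himp_bot := fun _ => rfl
      sdiff_le_iff := fun a b c => by
        constructor
        · intro h
          exact (le_sup_sub a b).trans (sup_le_sup_left h b)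
        · intro h
          refine le_trans ?_ (sub_sup_le c b)
          have h' : sup a (sup b c) = sup b c := sup_eq_right.2 h
          rw [← h']
          exact sub_mono a b _
      top_sdiff := fun _ => rfl }
  exact ⟨bi, fun _ _ => rfl, fun _ _ => rfl, fun _ _ => rfl, fun _ _ => rfl, rfl, rfl⟩

/-- Valid identities become universal sentences of the theory, so passing to models of the theory
adds no new structures. -/
theorem doubleHeyting_of_models {A : Type u} [inst : dhLang.Structure A]
    (h : A ⊨ theoryOf doubleHeyting.{u}) : doubleHeyting A inst := by
  refine doubleHeyting_of_forall_valid fun e he v => ?_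
  let φ : dhLang.Sentence :=
    BoundedFormula.alls (n := 3) (Term.bdEqual (e.1.relabel Sum.inr) (e.2.relabel Sum.inr))
  have hφ : ∀ (B : Type u) [dhLang.Structure B], B ⊨ φ ↔ ∀ v : Fin 3 → B, e.Holds v := by
    intro B _
    refine BoundedFormula.realize_alls.trans (forall_congr' fun v => ?_)
    rw [BoundedFormula.realize_bdEqual, Term.realize_relabel, Term.realize_relabel,
      Sum.elim_comp_inr, Eqn.Holds]
  have : φ ∈ theoryOf doubleHeyting.{u} := fun B _ hB => (hφ B).2 fun v => he B hB v (by simp)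
  exact (hφ A).1 (h.realize_of_mem φ this) v

/-! ### Ultrapowers over `ℕ` -/

/-- The ultrapower of `A` along a nonprincipal ultrafilter on `ℕ`. -/
abbrev NatUltrapower (A : Type u) : Type u :=
  (Filter.hyperfilter ℕ : Filter ℕ).Product fun _ => A

/-- The class of a sequence in the ultrapower. -/
noncomputable def NatUltrapower.mk {A : Type u} (x : ℕ → A) : NatUltrapower A := x

theorem NatUltrapower.exists_rep {A : Type u} (a : NatUltrapower A) :
    ∃ x : ℕ → A, NatUltrapower.mk x = a :=
  Quotient.exists_rep a

theorem NatUltrapower.mk_eq_iff {A : Type u} {x y : ℕ → A} :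
    NatUltrapower.mk x = NatUltrapower.mk y ↔ ∀ᶠ n in Filter.hyperfilter ℕ, x n = y n :=
  Quotient.eq''

theorem NatUltrapower.realize_mk {A : Type u} [dhLang.Structure A] {X : Type}
    (t : dhLang.Term X) (x : X → ℕ → A) :
    t.realize (fun i => NatUltrapower.mk (x i)) =
      NatUltrapower.mk fun n => t.realize fun i => x i n :=
  Ultraproduct.term_realize_cast x t

theorem holds_ultrapower_iff {A : Type u} [dhLang.Structure A] {X : Type} (e : Eqn dhLang X)
    (x : X → ℕ → A) :
    e.Holds (fun i => NatUltrapower.mk (x i)) ↔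
      ∀ᶠ n in Filter.hyperfilter ℕ, e.Holds fun i => x i n := by
  unfold Eqn.Holds
  rw [NatUltrapower.realize_mk, NatUltrapower.realize_mk, NatUltrapower.mk_eq_iff]

theorem doubleHeyting_ultrapower {A : Type u} [inst : dhLang.Structure A]
    (h : doubleHeyting A inst) : doubleHeyting (NatUltrapower A) inferInstance := by
  refine doubleHeyting_of_forall_valid fun e he v => ?_
  choose x hx using fun i => (v i).exists_rep
  rw [← funext hx, holds_ultrapower_iff]
  exact Filter.Eventually.of_forall fun n => he A h _ (by simp)

/-! ### Presented algebras -/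

section Presented

variable {X : Type}

/-- Derivability from `S` as an equivalence relation on terms. -/
def presentedSetoid (S : Set (Eqn dhLang X)) : Setoid (ULift.{u} (dhLang.Term X)) where
  r s t := Entails doubleHeyting.{u} S (s.down, t.down)
  iseqv :=
    { refl := fun _ _ _ _ _ _ => rfl
      symm := fun h A _ hA v hv => (h A hA v hv).symm
      trans := fun h h' A _ hA v hv => (h A hA v hv).trans (h' A hA v hv) }

instance (S : Set (Eqn dhLang X)) : dhLang.Prestructure (presentedSetoid.{u} S) where
  toStructure :=
    { funMap := fun f ts => ⟨.func f fun i => (ts i).down⟩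
      RelMap := fun r => (r : Empty).elim }
  fun_equiv := fun s t h A _ hA v hv => by
    have h' : ∀ i, (s i).down.realize v = (t i).down.realize v := fun i => h i A hA v hv
    simp only [Eqn.Holds, Term.realize, h']
  rel_equiv := fun {_ r} => (r : Empty).elim

/-- The double-Heyting algebra with generators `X` and relations `S`. -/
abbrev Presented (S : Set (Eqn dhLang X)) : Type u := Quotient (presentedSetoid.{u} S)

namespace Presented

/-- The element of the presented algebra named by a term. -/
def mk (S : Set (Eqn dhLang X)) (t : dhLang.Term X) : Presented.{u} S := ⟦⟨t⟩⟧

theorem mk_eq_iff {S : Set (Eqn dhLang X)} {s t : dhLang.Term X} :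
    mk.{u} S s = mk S t ↔ Entails doubleHeyting.{u} S (s, t) :=
  Quotient.eq

theorem exists_rep {S : Set (Eqn dhLang X)} (a : Presented.{u} S) : ∃ t, mk S t = a :=
  a.inductionOn fun t => ⟨t.down, rfl⟩

theorem funMap_mk (S : Set (Eqn dhLang X)) {n : ℕ} (f : dhLang.Functions n)
    (t : Fin n → dhLang.Term X) :
    Structure.funMap f (fun i => mk.{u} S (t i)) = mk S (.func f t) :=
  funMap_quotient_mk' (presentedSetoid.{u} S) f fun i => ⟨t i⟩

theorem realize_mk {Y : Type} (S : Set (Eqn dhLang X)) (t : dhLang.Term Y)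
    (σ : Y → dhLang.Term X) :
    t.realize (fun i => mk.{u} S (σ i)) = mk S (t.subst σ) := by
  induction t with
  | var => rfl
  | func f ts ih => simp only [Term.realize, Term.subst, ih, funMap_mk]

theorem subst_var (t : dhLang.Term X) : t.subst .var = t := by
  induction t with
  | var => rfl
  | func f ts ih => simp only [Term.subst, ih]

/-- Identifies the relations among selected generators with the consequences of `S` in those
variables. -/
theorem holds_mk_iff {Y : Type} (S : Set (Eqn dhLang X)) (e : Eqn dhLang Y) (f : Y → X) :
    e.Holds (fun i => mk.{u} S (.var (f i))) ↔ Entails doubleHeyting.{u} S (e.rename f) := by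
  rw [Eqn.Holds, realize_mk, realize_mk, mk_eq_iff]
  refine forall₄_congr fun A _ hA v => ?_
  simp only [Eqn.Holds, Eqn.rename, Term.realize_subst, Term.realize_relabel]
  rfl

theorem doubleHeyting_presented (S : Set (Eqn dhLang X)) :
    doubleHeyting (Presented.{u} S) inferInstance := by
  refine doubleHeyting_of_forall_valid fun e he v => ?_
  choose σ hσ using fun i => exists_rep (v i)
  rw [← funext hσ, Eqn.Holds, realize_mk, realize_mk, mk_eq_iff]
  intro A _ hA w _
  simp only [Eqn.Holds, Term.realize_subst]
  exact he A hA _ (by simp)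

/-- The homomorphism from a presented algebra given by an assignment that satisfies the
relations. -/
def lift (S : Set (Eqn dhLang X)) {B : Type u} [inst : dhLang.Structure B]
    (hB : doubleHeyting B inst) (v : X → B) (hv : ∀ s ∈ S, s.Holds v) :
    Presented.{u} S →[dhLang] B where
  toFun := Quotient.lift (fun t => t.down.realize v) fun _ _ h => h B hB v hv
  map_fun' := by
    intro n f x
    choose t ht using fun i => exists_rep (x i)
    rw [← funext ht, funMap_mk]
    rfl
  map_rel' := fun r => (r : Empty).elim

theorem finitelyPresented {n : ℕ} (S : Set (Eqn dhLang (Fin n))) (hS : S.Finite) :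
    FinitelyPresented doubleHeyting.{u} (Presented.{u} S) := by
  refine ⟨doubleHeyting_presented S, n, fun i => mk S (.var i), S, hS, ?_, ?_, ?_⟩
  · refine eq_top_iff.2 fun a _ => ?_
    obtain ⟨t, rfl⟩ := exists_rep a
    rw [← subst_var t, ← realize_mk]
    exact Term.realize_mem _ _ fun i => Substructure.subset_closure ⟨i, rfl⟩
  · intro r hr
    rw [Eqn.Holds, realize_mk, realize_mk, subst_var, subst_var, mk_eq_iff]
    exact fun A _ _ v hv => hv r hr
  · exact fun B _ hB h hh => ⟨lift S hB h hh, fun i => rfl⟩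

end Presented

end Presented

/-! ### The system `z ≤ x ≤ y`, `x ≤ ¬∼x` -/

section System

variable {X : Type}

/-- The equations expressing `z ≤ x`, `x ≤ y` and `x ≤ ¬∼x`. -/
def boxSystem (x y z : X) : Set (Eqn dhLang X) :=
  {leEqn (.var z) (.var x), leEqn (.var x) (.var y), leEqn (.var x) (boxT (.var x))}

theorem boxSystem_finite (x y z : X) : (boxSystem x y z).Finite := by
  simp [boxSystem]

theorem boxSystem_holds_iff {A : Type u} [dhLang.Structure A] [BiheytingAlgebra A]
    (hA : InterpretsOps A) {x y z : X} {v : X → A} :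
    (∀ s ∈ boxSystem x y z, s.Holds v) ↔ v z ≤ v x ∧ v x ≤ v y ∧ v x ≤ box (v x) := by
  simp only [boxSystem, Set.mem_insert_iff, Set.mem_singleton_iff, forall_eq_or_imp, forall_eq,
    hA.leEqn_holds, hA.realize_box, Term.realize_var]

theorem rename_holds {L : FirstOrder.Language.{0, 0}} {Y : Type} (f : X → Y) (e : Eqn L X) {A : Type u}
    [L.Structure A] (v : Y → A) : (e.rename f).Holds v ↔ e.Holds (v ∘ f) := by
  simp only [Eqn.Holds, Eqn.rename, Term.realize_relabel]

theorem holds_comp_iff {L : FirstOrder.Language.{0, 0}} {A B : Type u} [L.Structure A] [L.Structure B]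
    {F : Type*} [FunLike F A B] [HomClass L F A B] (f : F) (hf : Function.Injective f)
    (e : Eqn L X) (v : X → A) : e.Holds (f ∘ v) ↔ e.Holds v := by
  rw [Eqn.Holds, HomClass.realize_term, HomClass.realize_term, hf.eq_iff, Eqn.Holds]

/-- The consequences in `y, z` of the system `z ≤ x ≤ y`, `x ≤ ¬∼x`. -/
def boxConsequences : Set (Eqn dhLang (Fin 2)) :=
  {e | ∀ (B : Type u) [dhLang.Structure B] [BiheytingAlgebra B], InterpretsOps B →
    ∀ x y z : B, z ≤ x → x ≤ y → x ≤ box x → e.Holds ![y, z]}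

theorem leEqn_iterate_box_mem (n : ℕ) :
    leEqn (.var 1) (boxT^[n] (.var 0)) ∈ boxConsequences.{u} := by
  intro B _ _ hB x y z hzx hxy hx
  rw [hB.leEqn_holds, hB.realize_iterate_box]
  exact hzx.trans (le_iterate_box hxy hx n)

/-- An ultrapower of `A`, with the classes of `y` and of the powers of `¬∼` at `y`, extends to a
double-Heyting algebra with a solution of the system. -/
theorem exists_extension_ultrapower {A : Type u} [dhLang.Structure A] [BiheytingAlgebra A]
    (hA : InterpretsOps A) (y : A) :
    ∃ (B : Type u) (_ : dhLang.Structure B) (_ : BiheytingAlgebra B) (_ : InterpretsOps B)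
      (f : NatUltrapower A ↪[dhLang] B) (x : B),
      f (.mk fun n => box^[n] y) ≤ x ∧ x ≤ f (.mk fun _ => y) ∧ x ≤ box x := by
  obtain ⟨_, hU⟩ := doubleHeyting_ultrapower ⟨_, hA⟩
  refine exists_extension_le_box hU fun n => ?_
  have h : (leEqn (.var 1) (boxT^[n] (.var 0)) : Eqn dhLang (Fin 2)).Holds
      fun i => NatUltrapower.mk (![fun _ => y, fun k => box^[k] y] i) := by
    rw [holds_ultrapower_iff]
    -- The inequality for a fixed `n` holds at every coordinate `k ≥ n`, hence at almost all of
    -- them.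
    refine Filter.Eventually.filter_mono Nat.hyperfilter_le_atTop ?_
    filter_upwards [Filter.eventually_ge_atTop n] with k hk
    rw [hA.leEqn_holds, hA.realize_iterate_box]
    exact iterate_box_antitone y hk
  rw [hU.leEqn_holds, hU.realize_iterate_box] at h
  exact h

/-- Compactness: finitely many consequences hold at the pair in the ultrapower, so they hold
together at a single coordinate `n`, where the consequence with index `n + 1` fails. -/
theorem boxConsequences_not_finitely_based :
    ¬ ∃ P : Set (Eqn dhLang (Fin 2)), P.Finite ∧ P ⊆ boxConsequences.{u} ∧
      ∀ e ∈ boxConsequences.{u}, Entails doubleHeyting.{u} P e := by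
  rintro ⟨P, hP, hPsub, hPent⟩
  let A := LowerSet Fence.{u}
  let := dhStructure A
  have hA := interpretsOps_dhStructure A
  let y : A := Fence.tail 0
  obtain ⟨B, _, _, hB, f, x, hzx, hxy, hx⟩ := exists_extension_ultrapower hA y
  let w : Fin 2 → ℕ → A := ![fun _ => y, fun n => box^[n] y]
  have hev : ∀ᶠ n in Filter.hyperfilter ℕ, ∀ p ∈ P, p.Holds fun i => w i n := by
    rw [Filter.eventually_all_finite hP]
    intro p hp
    -- Equations pass back from the extension, where a solution makes every consequence true, to the
    -- ultrapower along the embedding.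
    rw [← holds_ultrapower_iff, ← holds_comp_iff f f.injective]
    convert hPsub hp B hB x _ _ hzx hxy hx using 1
    funext i
    fin_cases i <;> rfl
  obtain ⟨n, hn⟩ := hev.exists
  have h := hPent _ (leEqn_iterate_box_mem (n + 1)) A ⟨_, hA⟩ _ hn
  rw [hA.leEqn_holds, hA.realize_iterate_box] at h
  exact Fence.not_iterate_box_tail_le n h

end System

/-! ### Failure of right uniform deductive interpolation -/

theorem not_rightUniformDeductiveInterpolation :
    ¬ RightUniformDeductiveInterpolation doubleHeyting.{u} := by
  intro h
  obtain ⟨P, hP, hPS⟩ := h Unit (Fin 2) (boxSystem (.inl ()) (.inr 0) (.inr 1))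
    (boxSystem_finite _ _ _)
  refine boxConsequences_not_finitely_based ⟨P, hP, fun p hp B _ _ hB x y z hzx hxy hx => ?_,
    fun e he B _ ⟨_, hB⟩ v hv => ?_⟩
  -- No extra variables are needed. As `P` entails its own members, the interpolation property makes
  -- them consequences of the system.
  · have h' := (hPS Empty (p.rename Sum.inl)).2 (fun _ _ _ v hv => hv _ ⟨p, hp, rfl⟩) B ⟨_, hB⟩
      (Sum.elim (fun _ => x) (Sum.elim ![y, z] Empty.elim))
    rw [rename_holds, rename_holds] at h'
    refine h' ?_
    rintro _ ⟨s, hs, rfl⟩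
    rw [rename_holds]
    exact (boxSystem_holds_iff hB).2 ⟨hzx, hxy, hx⟩ s hs
  · have h' := (hPS Empty (e.rename Sum.inl)).1 ?_ B ⟨_, hB⟩ (Sum.elim v Empty.elim) ?_
    · rwa [rename_holds] at h'
    · rintro C _ ⟨_, hC⟩ w hw
      have hw' := (boxSystem_holds_iff hC).1 fun s hs => (rename_holds _ s w).1 (hw _ ⟨s, hs, rfl⟩)
      rw [rename_holds, rename_holds]
      convert he C hC _ _ _ hw'.1 hw'.2.1 hw'.2.2 using 1
      funext i
      fin_cases i <;> rfl
    · rintro _ ⟨p, hp, rfl⟩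
      rw [rename_holds]
      exact hv p hp

/-! ### Failure of coherence -/

theorem exists_term_of_mem_closure {A : Type u} [dhLang.Structure A] {X : Type} (v : X → A) {a : A}
    (ha : a ∈ Substructure.closure dhLang (Set.range v)) : ∃ t : dhLang.Term X, t.realize v = a := by
  obtain ⟨t, rfl⟩ := Substructure.mem_closure_iff_exists_term.1 ha
  choose g hg using fun i : Set.range v => i.2
  refine ⟨t.relabel g, ?_⟩
  rw [Term.realize_relabel]
  exact congrArg (fun w => t.realize w) (funext hg)

theorem not_coherent : ¬ Coherent doubleHeyting.{u} := by
  intro h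
  -- The variables `0, 1, 2` stand for `y, z, x`, so `castSucc` selects `y, z`.
  let S : Set (Eqn dhLang (Fin 3)) := boxSystem 2 0 1
  let c : Fin 2 → Fin 3 := Fin.castSucc
  let q : Fin 2 → Presented.{u} S := fun i => .mk S (.var (c i))
  have hq : ∀ e : Eqn dhLang (Fin 2), e.Holds q ↔ e ∈ boxConsequences.{u} := by
    intro e
    rw [Presented.holds_mk_iff]
    constructor
    · intro he B _ _ hB x y z hzx hxy hx
      have := he B ⟨_, hB⟩ ![y, z, x] ((boxSystem_holds_iff hB).2 ⟨hzx, hxy, hx⟩)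
      rw [rename_holds] at this
      convert this using 1
      funext i
      fin_cases i <;> rfl
    · rintro he B _ ⟨_, hB⟩ v hv
      have hv' := (boxSystem_holds_iff hB).1 hv
      rw [rename_holds]
      convert he B hB _ _ _ hv'.1 hv'.2.1 hv'.2.2 using 1
      funext i
      fin_cases i <;> rfl
  let K : dhLang.Substructure (Presented.{u} S) := Substructure.closure dhLang (Set.range q)
  have hKfg : K.FG := Substructure.fg_def.2 ⟨_, Set.finite_range q, rfl⟩
  obtain ⟨-, n, g, R, hR, hg, hRg, hext⟩ :=
    h _ (Presented.finitelyPresented S (boxSystem_finite _ _ _)) K hKfg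
  let q' : Fin 2 → K := fun i => ⟨q i, Substructure.subset_closure ⟨i, rfl⟩⟩
  have hq' : ∀ e : Eqn dhLang (Fin 2), e.Holds q' ↔ e ∈ boxConsequences.{u} := fun e => by
    rw [← hq, ← holds_comp_iff K.subtype K.subtype.injective]
    rfl
  choose t ht using fun i => exists_term_of_mem_closure q (g i).2
  have ht' : (fun i => (t i).realize q') = g := funext fun i => by
    apply K.subtype.injective
    rw [← HomClass.realize_term]
    exact ht i
  choose s hs using fun i => exists_term_of_mem_closure g (a := q' i) (hg ▸ trivial)
  -- A change of generators from `g` to `q'`: the relations `R` with `g` rewritten as terms `t` in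
  -- `q'`, plus equations recovering `q'` from these terms.
  let P : Set (Eqn dhLang (Fin 2)) := (fun r => (r.1.subst t, r.2.subst t)) '' R ∪
    Set.range fun i => ((s i).subst t, .var i)
  refine boxConsequences_not_finitely_based ⟨P, (hR.image _).union (Set.finite_range _), ?_,
    fun e he B _ hB v hv => ?_⟩
  · rintro _ (⟨r, hr, rfl⟩ | ⟨i, rfl⟩) <;> rw [← hq', Eqn.Holds] <;>
      simp only [Term.realize_subst, ht']
    · exact hRg r hr
    · exact hs i
  · obtain ⟨f, hf⟩ := hext B hB (fun i => (t i).realize v) fun r hr => by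
      have := hv _ (Or.inl ⟨r, hr, rfl⟩)
      simpa only [Eqn.Holds, Term.realize_subst] using this
    -- The recovery equations ensure that the homomorphism determined on `g` takes the prescribed
    -- values on `q'`.
    have hfq : f ∘ q' = v := funext fun i => by
      have := hv _ (Or.inr ⟨i, rfl⟩)
      simp only [Eqn.Holds, Term.realize_subst] at this
      rw [Function.comp_apply, ← hs, ← HomClass.realize_term, show f ∘ g = _ from funext hf]
      exact this
    rw [← hfq, Eqn.Holds, HomClass.realize_term, HomClass.realize_term]
    exact congrArg f ((hq' e).2 he)

/-! ### Failure of the existence of a model completion -/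

/-- The formula `∃ x, z ≤ x ≤ y ∧ x ≤ ¬∼x` in the variables `y, z`. -/
noncomputable def boxFormula : dhLang.Formula (Fin 2) :=
  let eqn (e : Eqn dhLang (Fin 2 ⊕ Unit)) : dhLang.Formula (Fin 2 ⊕ Unit) := Term.equal e.1 e.2
  Formula.iExs Unit (eqn (leEqn (.var (.inl 1)) (.var (.inr ()))) ⊓
    (eqn (leEqn (.var (.inr ())) (.var (.inl 0))) ⊓
      eqn (leEqn (.var (.inr ())) (boxT (.var (.inr ()))))))

theorem realize_boxFormula {A : Type u} [dhLang.Structure A] [BiheytingAlgebra A]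
    (hA : InterpretsOps A) (v : Fin 2 → A) :
    boxFormula.Realize v ↔ ∃ x, v 1 ≤ x ∧ x ≤ v 0 ∧ x ≤ box x := by
  rw [boxFormula, Formula.realize_iExs]
  simp only [Formula.realize_inf, Formula.realize_equal]
  constructor
  · rintro ⟨i, h₁, h₂, h₃⟩
    exact ⟨i (), by simpa using (hA.leEqn_holds _ _ _).1 h₁,
      by simpa using (hA.leEqn_holds _ _ _).1 h₂,
      by simpa [hA.realize_box] using (hA.leEqn_holds _ _ _).1 h₃⟩
  · rintro ⟨x, h₁, h₂, h₃⟩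
    exact ⟨fun _ => x, (hA.leEqn_holds _ _ _).2 (by simpa using h₁),
      (hA.leEqn_holds _ _ _).2 (by simpa using h₂),
      (hA.leEqn_holds _ _ _).2 (by simpa [hA.realize_box] using h₃)⟩

theorem models_theoryOf {L : FirstOrder.Language.{0, 0}} {V : AlgClass.{u} L} {A : Type u}
    [inst : L.Structure A] (hA : V A inst) : A ⊨ theoryOf V :=
  ⟨fun _ hφ => hφ A hA⟩

/-- The zigzag algebra is placed inside a model `N` of `T`, whose ultrapower is again a model of
`T`. A solution in an extension must then exist in the ultrapower itself, hence at some coordinate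
in `N`, where it stops the strict descent of the iterates. -/
theorem not_exists_isModelCompletion :
    ¬ ∃ T : dhLang.Theory, IsModelCompletion.{u} (theoryOf doubleHeyting.{u}) T := by
  rintro ⟨T, hT⟩
  let A := LowerSet Fence.{u}
  let := dhStructure A
  have hA := interpretsOps_dhStructure A
  obtain ⟨N, _, _, hNT, ⟨g⟩⟩ := hT.exists_embedding A (models_theoryOf ⟨_, hA⟩)
  obtain ⟨_, hN⟩ := doubleHeyting_of_models (hT.model_of_model N hNT)
  have hgbox : ∀ n a, g (box^[n] a) = box^[n] (g a) := fun n a => by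
    have := HomClass.realize_term (L := dhLang) g (t := boxT^[n] (.var ())) (v := fun _ : Unit => a)
    rw [hA.realize_iterate_box, hN.realize_iterate_box] at this
    exact this.symm
  let y : N := g (Fence.tail 0)
  have hy : ∀ n, ¬ box^[n] y ≤ box^[n + 1] y := fun n h => by
    refine Fence.not_iterate_box_tail_le.{u} n ?_
    have := (hN.leEqn_holds (.var 0) (.var 1) (g ∘ ![box^[n] (Fence.tail 0),
      box^[n + 1] (Fence.tail 0)])).2 (by
        simp only [Term.realize_var, Function.comp_apply]
        exact (hgbox _ _).trans_le (h.trans_eq (hgbox _ _).symm))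
    rw [holds_comp_iff g g.injective, hA.leEqn_holds] at this
    exact this
  have hWT : NatUltrapower N ⊨ T := ⟨fun φ hφ =>
    (Ultraproduct.sentence_realize φ).2 (Filter.Eventually.of_forall fun _ =>
      hNT.realize_of_mem φ hφ)⟩
  obtain ⟨B, _, _, hB, f, x, hzx, hxy, hx⟩ := exists_extension_ultrapower hN y
  obtain ⟨N', _, _, hN'T, ⟨k⟩⟩ := hT.exists_embedding B (models_theoryOf ⟨_, hB⟩)
  obtain ⟨_, hN'⟩ := doubleHeyting_of_models (hT.model_of_model N' hN'T)
  let w : Fin 2 → ℕ → N := ![fun _ => y, fun n => box^[n] y]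
  have hkf : boxFormula.Realize fun i => (k.comp f) (.mk (w i)) := by
    rw [realize_boxFormula hN']
    have h := (boxSystem_holds_iff hB (x := 2) (y := 0) (z := 1)
      (v := ![f (.mk fun _ => y), f (.mk fun n => box^[n] y), x])).2 ⟨hzx, hxy, hx⟩
    have h' := (boxSystem_holds_iff hN').1 fun s hs => (holds_comp_iff k k.injective s _).2 (h s hs)
    exact ⟨k x, h'⟩
  -- Completeness over the ultrapower compares its embedding in `N'` with its identity embedding.
  have hW : boxFormula.Realize fun i => NatUltrapower.mk (w i) :=
    (hT.complete_over (NatUltrapower N) (hT.model_of_model _ hWT) N' (NatUltrapower N) hN'T hWT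
      (k.comp f) (.refl dhLang _) 2 boxFormula fun i => .mk (w i)).1 hkf
  obtain ⟨n, hn⟩ := ((Ultraproduct.realize_formula_cast boxFormula w).1 hW).exists
  obtain ⟨x', hzx', hxy', hx'⟩ := (realize_boxFormula hN _).1 hn
  exact hy n (hzx'.trans (le_iterate_box hxy' hx' (n + 1)))

end UniformInterpolation

theorem corollary5p7 :
    ¬ UniformInterpolation.Coherent UniformInterpolation.doubleHeyting.{u} ∧
    ¬ UniformInterpolation.RightUniformDeductiveInterpolation
        UniformInterpolation.doubleHeyting.{u} ∧
    ¬ ∃ T : UniformInterpolation.dhLang.Theory,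
        UniformInterpolation.IsModelCompletion.{u}
          (UniformInterpolation.theoryOf UniformInterpolation.doubleHeyting.{u}) T :=
  ⟨UniformInterpolation.not_coherent,
    UniformInterpolation.not_rightUniformDeductiveInterpolation,
    UniformInterpolation.not_exists_isModelCompletion⟩
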